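/- **Setting.** There are players $p_1,\dots,p_N$ and arms $a_1,\dots,a_N$, where $a_i$ is the endowment of $p_i$. Let $\mathcal P$ be the set of all probability distributions supported in $[0,1]$. A bandit instance is a family $\nu=(\nu_{i,j})_{i,j\in[N]}$ with $\nu_{i,j}\in\mathcal P$ whose means $U(i,j)=\rho(\nu_{i,j})$ satisfy $U(i,j)\ne U(i,j')$ for $j\neq j'$. In each round every player proposes to an arm (or abstains). A player who is the only one to propose to $a_j$ is matched to it, and $p_i$ then receives a reward drawn from $\nu_{i,j}$; the rewards of the players in a round are independent given the proposals. All other players receive the reward $0$. A policy $\pi$ prescribes in each round a conditional distribution of the joint proposals given the past, and may depend on the horizon $T$; decentralized policies, in which each player decides from its own observations, are a special case. A core matching is a bijection $\mu^*$ from players to arms such that no nonempty coalition can reallocate the endowments of its members among themselves so that no member is worse off and some member is strictly better off; for strict preferences it exists and is unique. The core regret of $p_i$ is $$Reg_i(T;\nu,\pi)=T\,U(i,\mu^*(p_i))-\mathbb E_{\nu,\pi}\Big[\sum_{t=1}^T X_i(t)\Big],$$ where $X_i(t)$ is the reward of $p_i$ in round $t$. The policy $\pi$ is *uniformly consistent*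 if $\limsup_{T\to\infty} Reg_i(T;\nu,\pi)/T^{\alpha}\le 0$ for every instance $\nu$, every player $p_i$ and every $\alpha\in(0,1)$. For $\eta\in\mathcal P$ and $x\in\mathbb R$ put $D_{\inf}(\eta,x)=\inf\{D(\eta,\eta'):\eta'\in\mathcal P,\ \rho(\eta')>x\}\in[0,\infty]$, where $D$ is the Kullback–Leibler divergence and $\inf\emptyset=\infty$. **Theorem.** Let $\nu$ be a single-top-trading-cycle (STTCB) instance: the top arm of every player is its core partner $\mu^*(p_i)$, and there is an ordering $\sigma$ of the players with $\mu^*(p_{\sigma_k})=a_{\sigma_{k+1}}$ for $k<N$ and $\mu^*(p_{\sigma_N})=a_{\sigma_1}$. Put $\Delta^{(i)}_j=U(i,\mu^*(p_i))-U(i,j)$ and $\Delta^{(i)}_{\min}=\min_{a_j\ne\mu^*(p_i)}\Delta^{(i)}_j$. Then for every uniformly consistent policy $\pi$ (in particular every decentralized one) and every player $p_i$, $$\liminf_{T\to\infty}\frac{Reg_i(T;\nu,\pi)}{\log T}\ \ge\ \max\Bigg\{\sum_{i'\ne i}\frac{\Delta^{(i)}_{\min}}{D_{\inf}(\nu_{i',\mu^*(p_i)},U(i',\mu^*(p_{i'})))},\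 \sum_{a_j\ne\mu^*(p_i)}\frac{\Delta^{(i)}_j}{D_{\inf}(\nu_{i,j},U(i,\mu^*(p_i)))}\Bigg\},$$ with the convention $\Delta/\infty=0$. -/

import Mathlib

open MeasureTheory ProbabilityTheory Filter
open scoped ENNReal

noncomputable section

namespace HousingBandit

/-- The class of all probability distributions supported in `[0, 1]`. -/
def RewardDist : Set (Measure ℝ) :=
  {m | IsProbabilityMeasure m ∧ ∀ᵐ x ∂m, x ∈ Set.Icc (0 : ℝ) 1}

/-- The mean of a reward distribution. -/
def mean (m : Measure ℝ) : ℝ := ∫ x, x ∂m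

/-- `Dinf m x` is the infimum of `KL(m, m')` over all distributions `m'` supported in `[0, 1]` with
mean larger than `x` (it is `∞` if there is no such `m'`). -/
def Dinf (m : Measure ℝ) (x : ℝ) : ℝ≥0∞ :=
  ⨅ m' ∈ {m' ∈ RewardDist | x < mean m'}, InformationTheory.klDiv m m'

/-- A housing-market bandit instance with players `p_i` and arms `a_j`, `i j : Fin N`, where the arm
`a_i` is the endowment of `p_i`. The distribution of the reward that `p_i` receives when it is
matched to `a_j` is `law i j`. The preferences of each player are strict. -/
structure Instance (N : ℕ) where
  law : Fin N → Fin N → Measure ℝ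
  law_mem : ∀ i j, law i j ∈ RewardDist
  strict : ∀ i, Function.Injective fun j => mean (law i j)

/-- The set of proposals of a single player: an arm, or no arm at all. -/
instance instMeasurableSpaceOptionFin (N : ℕ) : MeasurableSpace (Option (Fin N)) := ⊤

instance (N : ℕ) : DiscreteMeasurableSpace (Option (Fin N)) := ⟨fun _ => trivial⟩

/-- The joint proposals of all players in one round (`none` means that the player abstains). -/
abbrev Proposals (N : ℕ) := Fin N → Option (Fin N)

/-- The record of one round: the joint proposals and the rewards of all players. -/
abbrev Round (N : ℕ) := Proposals N × (Fin N → ℝ)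

/-- The history of the first `t` rounds. -/
abbrev History (N t : ℕ) := Fin t → Round N

/-- The arm to which player `i` is matched: the arm that it proposes to, if no other player proposes
to this arm; otherwise player `i` is blocked and gets `none`. -/
def matchedArm {N : ℕ} (a : Proposals N) (i : Fin N) : Option (Fin N) :=
  if ∀ i', a i' = a i → i' = i then a i else none

/-- A policy: in every round `t`, a conditional distribution of the joint proposals of all players,
given the past. The proposals may be randomized and coordinated in an arbitrary way. Decentralized
policies, in which each player decides on the basis of its own observations, are special cases. -/
structure Policy (N : ℕ) where
  propose : (t : ℕ) → Kernel (History N t) (Proposals N)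
  isMarkov : ∀ t, IsMarkovKernel (propose t)

instance {N : ℕ} (π : Policy N) (t : ℕ) : IsMarkovKernel (π.propose t) := π.isMarkov t

namespace Instance

variable {N : ℕ}

/-- The utility matrix: the mean rewards. -/
def utility (ν : Instance N) (i j : Fin N) : ℝ := mean (ν.law i j)

/-- The distribution of the reward of player `i` under the joint proposals `a`: the law of the
matched pair, or the deterministic reward `0` if the player is not matched. -/
def rewardLaw (ν : Instance N) (a : Proposals N) (i : Fin N) : Measure ℝ :=
  match matchedArm a i with
  | some j => ν.law i j
  | none => Measure.dirac 0

instance (ν : Instance N) (a : Proposals N) (i : Fin N) :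
    IsProbabilityMeasure (ν.rewardLaw a i) := by
  unfold rewardLaw
  split
  · exact (ν.law_mem _ _).1
  · infer_instance

/-- The joint distribution of the rewards of all players, given the joint proposals. -/
def rewardKernel (ν : Instance N) : Kernel (Proposals N) (Fin N → ℝ) :=
  Kernel.ofFunOfCountable fun a => Measure.pi (ν.rewardLaw a)

instance (ν : Instance N) : IsMarkovKernel ν.rewardKernel :=
  ⟨fun a => inferInstanceAs (IsProbabilityMeasure (Measure.pi (ν.rewardLaw a)))⟩

/-- The conditional distribution of round `t`, given the history of the previous rounds. -/
def roundKernel (ν : Instance N) (π : Policy N) (t : ℕ) : Kernel (History N t) (Round N) :=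
  (π.propose t) ⊗ₖ (ν.rewardKernel.prodMkLeft (History N t))

instance (ν : Instance N) (π : Policy N) (t : ℕ) : IsMarkovKernel (ν.roundKernel π t) := by
  unfold roundKernel; infer_instance

/-- The law of the history of the first `T` rounds when the players follow `π` on `ν`. -/
def historyLaw (ν : Instance N) (π : Policy N) : (T : ℕ) → Measure (History N T)
  | 0 => Measure.dirac Fin.elim0
  | T + 1 => (ν.historyLaw π T ⊗ₘ ν.roundKernel π T).map
      fun p => (Fin.snoc p.1 p.2 : History N (T + 1))

lemma measurable_snoc (T : ℕ) :
    Measurable fun p : History N T × Round N => (Fin.snoc p.1 p.2 : History N (T + 1)) := by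
  refine measurable_pi_lambda _ fun k => ?_
  refine Fin.lastCases ?_ (fun k => ?_) k
  · simpa using measurable_snd
  · simp only [Fin.snoc_castSucc]
    exact (measurable_pi_apply k).comp measurable_fst

instance (ν : Instance N) (π : Policy N) (T : ℕ) : IsProbabilityMeasure (ν.historyLaw π T) := by
  induction T with
  | zero => unfold historyLaw; infer_instance
  | succ T ih =>
    unfold historyLaw
    exact Measure.isProbabilityMeasure_map (measurable_snoc T).aemeasurable

/-- The core, for strict preferences: no nonempty coalition `S` can reallocate the endowments of its
members among themselves so that no member is worse off and at least one member is better off. -/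
def IsCoreMatching (ν : Instance N) (μ : Equiv.Perm (Fin N)) : Prop :=
  ¬ ∃ (S : Finset (Fin N)) (τ : Equiv.Perm (Fin N)), (∀ k ∈ S, τ k ∈ S) ∧
    (∀ k ∈ S, ν.utility k (μ k) ≤ ν.utility k (τ k)) ∧
    ∃ k ∈ S, ν.utility k (μ k) < ν.utility k (τ k)

/-- The core regret of player `i` over `T` rounds, for the core matching `μ`. -/
def coreRegret (ν : Instance N) (μ : Equiv.Perm (Fin N)) (π : Policy N) (i : Fin N) (T : ℕ) : ℝ :=
  T * ν.utility i (μ i) - ∫ h, ∑ t : Fin T, (h t).2 i ∂(ν.historyLaw π T)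

/-- A single-top-trading-cycle instance with core matching `μ`: all players form one cycle of the
core matching, and the core partner of each player is its unique top-ranked arm. -/
structure IsSTTCB (ν : Instance N) (μ : Equiv.Perm (Fin N)) : Prop where
  core : ν.IsCoreMatching μ
  cycle : μ.IsCycleOn Set.univ
  top : ∀ i j, j ≠ μ i → ν.utility i j < ν.utility i (μ i)

/-- The gap between the core partner of player `i` and the arm `j`. -/
def gap (ν : Instance N) (μ : Equiv.Perm (Fin N)) (i j : Fin N) : ℝ :=
  ν.utility i (μ i) - ν.utility i j

/-- The minimum gap of player `i` over the arms other than its core partner. -/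
def minGap (ν : Instance N) (μ : Equiv.Perm (Fin N)) (i : Fin N) : ℝ :=
  ⨅ j : {j : Fin N // j ≠ μ i}, ν.gap μ i j

end Instance

/-- Uniform consistency: on every instance, the regret of every player grows more slowly than every
positive power of the horizon. The policy may depend on the horizon: `π T` is used for the horizon
`T`; an anytime policy is a constant family. -/
def IsUniformlyConsistent {N : ℕ} (π : ℕ → Policy N) : Prop :=
  ∀ (ν : Instance N) (μ : Equiv.Perm (Fin N)), ν.IsCoreMatching μ →
    ∀ (i : Fin N) (α : ℝ), 0 < α → α < 1 →
      limsup (fun T : ℕ => ((ν.coreRegret μ (π T) i T / (T : ℝ) ^ α : ℝ) : EReal)) atTop ≤ 0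

end HousingBandit

end

noncomputable section

namespace HousingBandit

/-! This is a change-of-measure argument. For a pair `(i, j)` outside the core, replace its reward
law by some `m` whose mean exceeds `ν.utility i (μ i)`. On a single trading cycle, player `i`
wanting `j` closes the path from `j` along the cycle to `i` into a new cycle of top choices, so
every core matching of the new instance assigns `j` to `i` (`IsSTTCB.update_core`). Consistency on
both instances then forces the pair to be matched rarely under `ν` and almost always under the
alternative. The history laws differ only through rewards of this pair, so their relative entropy is
at most the expected number of matches times `klDiv (ν.law i j) m` (`entropyBound_historyLaw`).
Telling the instances apart with error `T ^ (α - 1)` for every `α > 0` requires about `log T`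
entropy, whence the matches number at least `log T / klDiv`
(`eventually_mul_log_le_expectedMatches`); optimizing over `m` gives `Dinf`.

Two pointwise regret decompositions turn match counts into the two sums: player `i` pays for its own
matches to inferior arms, and for rounds in which another player holds its core partner.

Relative entropy enters only through its variational form, for which data processing is composition
with a map and the chain rule is iterated integration; no density of a history law is needed. -/

/-- A Donsker–Varadhan bound: `c` dominates the relative entropy of `P` with respect to `Q`, in its
variational form over bounded measurable functions. -/
def EntropyBound {Ω : Type*} [MeasurableSpace Ω] (P Q : Measure Ω) (c : ℝ) : Prop :=
  ∀ f : Ω → ℝ, Measurable f → ∀ C : ℝ, (∀ x, |f x| ≤ C) →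
    ∫ x, f x ∂P ≤ c + Real.log (∫ x, Real.exp (f x) ∂Q)

/-! ### Variational relative entropy: data processing and chain rule -/

section Entropy

variable {Ω Ω' : Type*} [MeasurableSpace Ω] [MeasurableSpace Ω']

lemma integrable_of_abs_le {P : Measure Ω} [IsFiniteMeasure P] {f : Ω → ℝ} (hf : Measurable f)
    {C : ℝ} (hC : ∀ x, |f x| ≤ C) : Integrable f P :=
  Integrable.of_bound hf.aestronglyMeasurable C (ae_of_all _ hC)

lemma integrable_exp_of_abs_le {P : Measure Ω} [IsFiniteMeasure P] {f : Ω → ℝ} (hf : Measurable f)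
    {C : ℝ} (hC : ∀ x, |f x| ≤ C) : Integrable (fun x => Real.exp (f x)) P :=
  integrable_of_abs_le hf.exp (C := Real.exp C) fun x => by
    rw [Real.abs_exp]; exact Real.exp_le_exp.2 ((le_abs_self _).trans (hC x))

lemma integrable_integral_kernel {P : Measure Ω} [SFinite P] {κ : Kernel Ω Ω'} [IsSFiniteKernel κ]
    {f : Ω × Ω' → ℝ} (hf : Integrable f (P ⊗ₘ κ)) :
    Integrable (fun a => ∫ b, f (a, b) ∂(κ a)) P := by
  rw [Measure.compProd] at hf
  simpa using MeasureTheory.Integrable.integral_compProd hf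

/-- The Donsker–Varadhan inequality. -/
lemma EntropyBound.of_klDiv_ne_top {P Q : Measure Ω} [IsProbabilityMeasure P]
    [IsProbabilityMeasure Q] (h : InformationTheory.klDiv P Q ≠ ∞) :
    EntropyBound P Q (InformationTheory.klDiv P Q).toReal := by
  intro f hf C hC
  obtain ⟨hac, hint⟩ := InformationTheory.klDiv_ne_top_iff.1 h
  have hfP : Integrable f P := integrable_of_abs_le hf hC
  have hfQ : Integrable (fun x => Real.exp (f x)) Q := integrable_exp_of_abs_le hf hC
  have : IsProbabilityMeasure (Q.tilted f) := isProbabilityMeasure_tilted hfQ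
  have hac' : P ≪ Q.tilted f := hac.trans (absolutelyContinuous_tilted hfQ)
  -- Gibbs' inequality for `P` against `Q` tilted by `f`; expanding the log-likelihood ratio yields
  -- the claim.
  have key := InformationTheory.integral_llr_add_sub_measure_univ_nonneg hac'
    (integrable_llr_tilted_right hac hfP hint hfQ)
  rw [integral_llr_tilted_right hac hfP hfQ hint] at key
  rw [InformationTheory.toReal_klDiv_of_measure_eq hac (by simp)]
  simp only [probReal_univ] at key
  linarith

lemma EntropyBound.refl (P : Measure Ω) [IsProbabilityMeasure P] : EntropyBound P P 0 := by
  simpa using EntropyBound.of_klDiv_ne_top (P := P) (Q := P) (by simp)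

lemma EntropyBound.map {P Q : Measure Ω} {c : ℝ} (h : EntropyBound P Q c) {g : Ω → Ω'}
    (hg : Measurable g) : EntropyBound (P.map g) (Q.map g) c := by
  intro f hf C hC
  rw [integral_map hg.aemeasurable hf.aestronglyMeasurable,
    integral_map hg.aemeasurable hf.exp.aestronglyMeasurable]
  exact h _ (hf.comp hg) C fun x => hC _

/-- Chain rule. Testing the kernels with `f (a, ·)` leaves the log-moment `g a`, which inherits the
bound `C` and is thus an admissible test function for `P` and `Q`; exponentiating it restores the
iterated integral. -/
lemma EntropyBound.compProd {P Q : Measure Ω} [IsProbabilityMeasure P] [IsProbabilityMeasure Q]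
    {κ κ' : Kernel Ω Ω'} [IsMarkovKernel κ] [IsMarkovKernel κ'] {c : ℝ} {d : Ω → ℝ}
    (h : EntropyBound P Q c) (hκ : ∀ a, EntropyBound (κ a) (κ' a) (d a)) (hd : Integrable d P) :
    EntropyBound (P ⊗ₘ κ) (Q ⊗ₘ κ') (c + ∫ a, d a ∂P) := by
  intro f hf C hC
  have hfm (a : Ω) : Measurable fun b => f (a, b) := hf.comp measurable_prodMk_left
  have hintP : Integrable f (P ⊗ₘ κ) := integrable_of_abs_le hf hC
  have hintQ : Integrable (fun x => Real.exp (f x)) (Q ⊗ₘ κ') := integrable_exp_of_abs_le hf hC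
  have hpos (a : Ω) : 0 < ∫ b, Real.exp (f (a, b)) ∂(κ' a) :=
    integral_exp_pos (integrable_exp_of_abs_le (hfm a) fun _ => hC _)
  set g : Ω → ℝ := fun a => Real.log (∫ b, Real.exp (f (a, b)) ∂(κ' a)) with hgdef
  have hgm : Measurable g :=
    (StronglyMeasurable.integral_kernel_prod_right'
      (f := fun p => Real.exp (f p)) hf.exp.stronglyMeasurable).measurable.log
  have hgC (a : Ω) : |g a| ≤ C := by
    have hi := integrable_exp_of_abs_le (P := κ' a) (hfm a) fun _ => hC _
    rw [abs_le]
    constructor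
    · rw [hgdef, Real.le_log_iff_exp_le (hpos a)]
      have := integral_mono (μ := κ' a) (integrable_const (Real.exp (-C))) hi
        fun b => Real.exp_le_exp.2 (abs_le.1 (hC (a, b))).1
      simpa using this
    · rw [hgdef, Real.log_le_iff_le_exp (hpos a)]
      have := integral_mono (μ := κ' a) hi (integrable_const (Real.exp C))
        fun b => Real.exp_le_exp.2 (abs_le.1 (hC (a, b))).2
      simpa using this
  have hgint : Integrable g P := integrable_of_abs_le hgm hgC
  rw [Measure.integral_compProd hintP, Measure.integral_compProd hintQ]
  calc ∫ a, ∫ b, f (a, b) ∂(κ a) ∂P ≤ ∫ a, (d a + g a) ∂P :=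
        integral_mono (integrable_integral_kernel hintP) (hd.add hgint) fun a => hκ a _ (hfm a) C fun _ => hC _
    _ = ∫ a, d a ∂P + ∫ a, g a ∂P := integral_add hd hgint
    _ ≤ ∫ a, d a ∂P + (c + Real.log (∫ a, Real.exp (g a) ∂Q)) := by
        gcongr; exact h g hgm C hgC
    _ = _ := by
        simp only [hgdef, Real.exp_log (hpos _)]; ring

/-- Split off coordinate `i`: the remaining product is common to both sides and adds zero entropy.
-/
lemma EntropyBound.pi {n : ℕ} {P Q : Fin n → Measure ℝ} [∀ k, IsProbabilityMeasure (P k)]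
    [∀ k, IsProbabilityMeasure (Q k)] {i : Fin n} {c : ℝ} (h : EntropyBound (P i) (Q i) c)
    (hPQ : ∀ k, k ≠ i → P k = Q k) : EntropyBound (Measure.pi P) (Measure.pi Q) c := by
  cases n with
  | zero => exact i.elim0
  | succ n =>
    have hP := (measurePreserving_piFinSuccAbove P i).symm
    have hQ := (measurePreserving_piFinSuccAbove Q i).symm
    rw [← hP.map_eq, ← hQ.map_eq]
    refine EntropyBound.map ?_ (MeasurableEquiv.measurable _)
    have hrest : (fun k => P (i.succAbove k)) = fun k => Q (i.succAbove k) :=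
      funext fun k => hPQ _ (Fin.succAbove_ne i k)
    rw [hrest, ← Measure.compProd_const, ← Measure.compProd_const]
    have := h.compProd (d := fun _ => 0)
      (κ := Kernel.const ℝ (Measure.pi fun k => Q (i.succAbove k)))
      (κ' := Kernel.const ℝ (Measure.pi fun k => Q (i.succAbove k)))
      (fun a => by simpa using EntropyBound.refl _) (integrable_zero _ _ _)
    simpa using this

end Entropy

/-! ### Top trading cycles and existence of the core -/

/-- A self-map of a nonempty finite set permutes some nonempty subset. -/
lemma exists_nonempty_bijOn {ι : Type*} [DecidableEq ι] {f : ι → ι} {R : Finset ι}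
    (hR : R.Nonempty) (hf : ∀ k ∈ R, f k ∈ R) :
    ∃ C ⊆ R, C.Nonempty ∧ Set.BijOn f C C := by
  induction R using Finset.strongInduction with
  | H R ih =>
    by_cases h : R.image f = R
    · refine ⟨R, subset_rfl, hR, ?_⟩
      have hs : Set.SurjOn f R R := by
        intro x hx
        rw [← h] at hx
        simpa using hx
      exact ⟨hf, Finset.injOn_of_surjOn_of_card_le f hf hs le_rfl, hs⟩
    · have hss : R.image f ⊂ R := (Finset.image_subset_iff.2 hf).ssubset_of_ne h
      obtain ⟨C, hC, hne, hb⟩ := ih _ hss (hR.image f) fun k hk =>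
        Finset.mem_image_of_mem f (hss.1 hk)
      exact ⟨C, hC.trans hss.1, hne, hb⟩

/-- Top trading cycles: in every submarket of a market with strict preferences there is an
assignment that coincides with each reallocation inside a coalition that harms no member. -/
lemma exists_topTradingCycles {ι : Type*} [DecidableEq ι] [Fintype ι] (u : ι → ι → ℝ)
    (hu : ∀ k, Function.Injective (u k)) (R : Finset ι) :
    ∃ σ : Equiv.Perm ι, (∀ k, k ∉ R → σ k = k) ∧ ∀ S ⊆ R, ∀ τ : Equiv.Perm ι,
      (∀ k ∈ S, τ k ∈ S) → (∀ k ∈ S, u k (σ k) ≤ u k (τ k)) → ∀ k ∈ S, τ k = σ k := by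
  induction R using Finset.strongInduction with
  | H R ih =>
    rcases R.eq_empty_or_nonempty with rfl | hR
    · refine ⟨1, fun _ _ => rfl, fun S hS τ _ _ k hk => absurd (hS hk) (by simp)⟩
    -- Everyone points to a favourite in `R`; `C` is a union of cycles of this pointing map. They
    -- trade along `f`, and the rest `R \ C` is handled by induction.
    choose f hfR hf using fun k => R.exists_max_image (u k) hR
    obtain ⟨C, hCR, hCne, hC⟩ := exists_nonempty_bijOn hR fun k _ => hfR k
    obtain ⟨σ, hσ, hσ'⟩ := ih (R \ C) (Finset.sdiff_ssubset hCR hCne)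
    classical
    let e : Equiv.Perm {k // k ∈ C} := hC.equiv f
    let ρ : Equiv.Perm ι := Equiv.Perm.ofSubtype e
    have hρC (k) (hk : k ∈ C) : ρ k = f k := by
      simp only [ρ]
      rw [Equiv.Perm.ofSubtype_apply_of_mem e hk]; rfl
    have hρ (k) (hk : k ∉ C) : ρ k = k := Equiv.Perm.ofSubtype_apply_of_not_mem e hk
    have hσmem (k) (hk : k ∉ C) : σ k ∉ C := by
      intro h
      have h1 : σ (σ k) = σ k := hσ _ (by simp [h])
      exact hk (by rwa [σ.injective h1] at h)
    have hvC (k) (hk : k ∈ C) : (ρ * σ) k = f k := by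
      rw [Equiv.Perm.mul_apply, hσ k (by simp [hk]), hρC k hk]
    have hv (k) (hk : k ∉ C) : (ρ * σ) k = σ k := by
      rw [Equiv.Perm.mul_apply, hρ _ (hσmem k hk)]
    refine ⟨ρ * σ, fun k hk => ?_, fun S hS τ hτS hτ => ?_⟩
    · rw [hv k (fun h => hk (hCR h)), hσ k (by simp [hk])]
    have htop (k) (hkS : k ∈ S) (hkC : k ∈ C) : τ k = f k := by
      refine hu k (le_antisymm (hf k _ (hS (hτS k hkS))) ?_)
      simpa only [hvC k hkC] using hτ k hkS
    -- A harmless `τ` agrees with `f` on `C ∩ S`, hence permutes it by counting; injectivity keeps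
    -- all other members of `S` out of `C`.
    have hout (k) (hkS : k ∈ S) (hkC : k ∉ C) : τ k ∉ C := by
      have hCS : (C ∩ S).image τ = C ∩ S := by
        refine Finset.eq_of_subset_of_card_le ?_ (Finset.card_image_of_injective _ τ.injective).ge
        intro x hx
        obtain ⟨y, hy, rfl⟩ := Finset.mem_image.1 hx
        obtain ⟨hyC, hyS⟩ := Finset.mem_inter.1 hy
        refine Finset.mem_inter.2 ⟨?_, hτS y hyS⟩
        rw [htop y hyS hyC]; exact hC.mapsTo hyC
      intro h
      have : τ k ∈ (C ∩ S).image τ := by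
        rw [hCS]; exact Finset.mem_inter.2 ⟨h, hτS k hkS⟩
      obtain ⟨y, hy, hyk⟩ := Finset.mem_image.1 this
      rw [τ.injective hyk] at hy
      exact hkC (Finset.mem_inter.1 hy).1
    intro k hk
    by_cases hkC : k ∈ C
    · rw [htop k hk hkC, hvC k hkC]
    · rw [hv k hkC]
      refine hσ' (S \ C) (Finset.sdiff_subset_sdiff hS subset_rfl) τ ?_ ?_ k (by simp [hk, hkC])
      · intro l hl
        obtain ⟨hlS, hlC⟩ := Finset.mem_sdiff.1 hl
        exact Finset.mem_sdiff.2 ⟨hτS l hlS, hout l hlS hlC⟩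
      · intro l hl
        obtain ⟨hlS, hlC⟩ := Finset.mem_sdiff.1 hl
        simpa only [hv l hlC] using hτ l hlS

/-! ### The alternative instance and its core -/

namespace Instance

variable {N : ℕ}

/-- Consistency speaks only about core matchings, so it can be used on the alternative instance only
once one is known to exist there. -/
lemma exists_isCoreMatching (ν : Instance N) : ∃ μ, ν.IsCoreMatching μ := by
  obtain ⟨σ, -, h⟩ := exists_topTradingCycles ν.utility ν.strict Finset.univ
  refine ⟨σ, ?_⟩
  rintro ⟨S, τ, hS, hle, k, hk, hlt⟩
  rw [h S (Finset.subset_univ _) τ hS hle k hk] at hlt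
  exact lt_irrefl _ hlt

/-- The core matches the members of a coalition to their top arms, if these are the endowments of
the coalition. -/
lemma IsCoreMatching.apply_eq {ν : Instance N} {μ τ : Equiv.Perm (Fin N)}
    (hμ : ν.IsCoreMatching μ) {S : Finset (Fin N)} (hS : ∀ k ∈ S, τ k ∈ S)
    (hτ : ∀ k ∈ S, ∀ j, ν.utility k j ≤ ν.utility k (τ k)) {k : Fin N} (hk : k ∈ S) :
    μ k = τ k := by
  by_contra hne
  exact hμ ⟨S, τ, hS, fun k hk => hτ k hk _, k, hk,
    (hτ k hk _).lt_of_ne fun h => hne (ν.strict k h)⟩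

/-- Replace the reward distribution of the pair `(i, j)` by one whose mean exceeds all means
of player `i`. -/
def update (ν : Instance N) (i j : Fin N) (m : Measure ℝ) (hm : m ∈ RewardDist)
    (htop : ∀ j', ν.utility i j' < mean m) : Instance N where
  law k l := if k = i ∧ l = j then m else ν.law k l
  law_mem k l := by
    split_ifs
    · exact hm
    · exact ν.law_mem k l
  strict k := by
    intro l l' h
    have h1 := htop l
    have h2 := htop l'
    by_cases hk : k = i
    · subst hk
      by_cases hl : l = j <;> by_cases hl' : l' = j
      · rw [hl, hl']
      · simp only [hl, hl', and_true, and_false, if_true, if_false] at h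
        exact absurd h h2.ne'
      · simp only [hl, hl', and_true, and_false, if_true, if_false] at h
        exact absurd h h1.ne
      · simp only [hl, hl', and_false, if_false] at h
        exact ν.strict k h
    · simp only [hk, false_and, if_false] at h
      exact ν.strict k h

variable {ν : Instance N} {i j : Fin N} {m : Measure ℝ} {hm : m ∈ RewardDist}
  {htop : ∀ j', ν.utility i j' < mean m}

@[simp]
lemma update_law_self : (ν.update i j m hm htop).law i j = m := by simp [update]

lemma update_law_of_ne {k l : Fin N} (h : ¬ (k = i ∧ l = j)) :
    (ν.update i j m hm htop).law k l = ν.law k l := by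
  simp only [update, if_neg h]

lemma update_utility_self : (ν.update i j m hm htop).utility i j = mean m := by
  simp [utility]

lemma update_utility_of_ne {k l : Fin N} (h : ¬ (k = i ∧ l = j)) :
    (ν.update i j m hm htop).utility k l = ν.utility k l := by
  simp only [utility, update_law_of_ne h]

/-- If in a single-top-trading-cycle instance another arm becomes the top arm of player `i`,
then the core matches player `i` to this arm. -/
lemma IsSTTCB.update_core {μ μ' : Equiv.Perm (Fin N)} (hν : ν.IsSTTCB μ)
    (hμ' : (ν.update i j m hm htop).IsCoreMatching μ') : μ' i = j := by
  have hex : ∃ n : ℕ, (μ ^ n) j = i :=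
    hν.cycle.exists_pow_eq' Set.finite_univ (Set.mem_univ j) (Set.mem_univ i)
  classical
  set n := Nat.find hex with hn
  have hni : (μ ^ n) j = i := Nat.find_spec hex
  have hmin {k : ℕ} (hk : k < n) : (μ ^ k) j ≠ i := Nat.find_min hex hk
  -- The coalition is the shortest path `j, μ j, …, i`; `τ` follows `μ` along it and closes it by
  -- sending `i` to `j`.
  set S := (Finset.range (n + 1)).image fun k => (μ ^ k) j with hSdef
  set τ : Equiv.Perm (Fin N) := Equiv.swap (μ i) j * μ with hτdef
  have hτi : τ i = j := by simp [hτdef]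
  have hτne (k) (hk : k ∈ S) (hki : k ≠ i) : τ k = μ k ∧ μ k ∈ S ∧ μ k ≠ j := by
    obtain ⟨a, ha, rfl⟩ := Finset.mem_image.1 hk
    have han : a < n := by
      rcases (Nat.lt_succ_iff.1 (Finset.mem_range.1 ha)).lt_or_eq with h | h
      · exact h
      · exact absurd (h ▸ hni) hki
    have hsucc : μ ((μ ^ a) j) = (μ ^ (a + 1)) j := by rw [pow_succ', Equiv.Perm.mul_apply]
    -- A return to `j` before reaching `i` would shorten the path, against the minimality of `n`.
    have hj' : μ ((μ ^ a) j) ≠ j := by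
      rw [hsucc]
      intro h
      refine hmin (k := n - (a + 1)) (by omega) ?_
      rw [← hni]
      conv_rhs => rw [← Nat.sub_add_cancel (Nat.succ_le_of_lt han), pow_add,
        Equiv.Perm.mul_apply, h]
    refine ⟨?_, ?_, hj'⟩
    · rw [hτdef, Equiv.Perm.mul_apply, Equiv.swap_apply_of_ne_of_ne (fun h => hki (μ.injective h))
        hj']
    · rw [hsucc]
      exact Finset.mem_image_of_mem _ (Finset.mem_range.2 (by omega))
  have hiS : i ∈ S := Finset.mem_image.2 ⟨n, by simp, hni⟩
  have hjS : j ∈ S := Finset.mem_image.2 ⟨0, by simp, by simp⟩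
  rw [← hτi]
  refine hμ'.apply_eq (S := S) (τ := τ) (fun k hk => ?_) (fun k hk l => ?_) hiS
  · by_cases hki : k = i
    · rw [hki, hτi]; exact hjS
    · rw [(hτne k hk hki).1]; exact (hτne k hk hki).2.1
  · by_cases hki : k = i
    · rw [hki, hτi, update_utility_self]
      by_cases hl : l = j
      · rw [hl, update_utility_self]
      · rw [update_utility_of_ne (by simp [hl])]; exact (htop l).le
    · rw [(hτne k hk hki).1, update_utility_of_ne (by simp [hki]),
        update_utility_of_ne (by simp [hki])]
      by_cases hl : l = μ k
      · rw [hl]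
      · exact (hν.top k l hl).le

end Instance

/-! ### Expected totals over rounds -/

namespace Instance

variable {N : ℕ}

/-- The mean reward of player `i` under the joint proposals `a`. -/
def meanReward (ν : Instance N) (i : Fin N) (a : Proposals N) : ℝ := mean (ν.rewardLaw a i)

lemma meanReward_of_eq_some {ν : Instance N} {i j : Fin N} {a : Proposals N}
    (h : matchedArm a i = some j) : ν.meanReward i a = ν.utility i j := by
  simp only [meanReward, rewardLaw, h, utility]

lemma meanReward_of_eq_none {ν : Instance N} {i : Fin N} {a : Proposals N}
    (h : matchedArm a i = none) : ν.meanReward i a = 0 := by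
  simp only [meanReward, rewardLaw, h, mean, integral_dirac]

lemma utility_nonneg (ν : Instance N) (i j : Fin N) : 0 ≤ ν.utility i j :=
  integral_nonneg_of_ae ((ν.law_mem i j).2.mono fun _ hx => hx.1)

lemma rewardLaw_ae_mem (ν : Instance N) (a : Proposals N) (i : Fin N) :
    ∀ᵐ x ∂(ν.rewardLaw a i), x ∈ Set.Icc (0 : ℝ) 1 := by
  unfold rewardLaw
  split
  · exact (ν.law_mem _ _).2
  · exact (ae_dirac_iff measurableSet_Icc).2 (by simp)

lemma rewardKernel_apply (ν : Instance N) (a : Proposals N) :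
    ν.rewardKernel a = Measure.pi (ν.rewardLaw a) := rfl

lemma roundKernel_apply (ν : Instance N) (π : Policy N) (t : ℕ) (h : History N t) :
    ν.roundKernel π t h = π.propose t h ⊗ₘ ν.rewardKernel := by
  rw [roundKernel, Kernel.compProd_apply_eq_compProd_sectR]
  rfl

lemma historyLaw_succ (ν : Instance N) (π : Policy N) (T : ℕ) :
    ν.historyLaw π (T + 1) = (ν.historyLaw π T ⊗ₘ ν.roundKernel π T).map
      fun p => (Fin.snoc p.1 p.2 : History N (T + 1)) := rfl

/-- A function of one round that is almost surely bounded by `C`, whatever the proposals are. -/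
structure IsRoundBounded (ν : Instance N) (g : Round N → ℝ) (C : ℝ) : Prop where
  measurable : Measurable g
  bound : ∀ a, ∀ᵐ x ∂(ν.rewardKernel a), |g (a, x)| ≤ C

namespace IsRoundBounded

variable {ν : Instance N} {g : Round N → ℝ} {C : ℝ}

lemma measurableSet (hg : ν.IsRoundBounded g C) : MeasurableSet {r | |g r| ≤ C} :=
  measurableSet_le hg.measurable.abs measurable_const

lemma ae_roundKernel (hg : ν.IsRoundBounded g C) (π : Policy N) (t : ℕ) (h : History N t) :
    ∀ᵐ r ∂(ν.roundKernel π t h), |g r| ≤ C := by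
  rw [roundKernel_apply]
  exact Measure.ae_compProd_of_ae_ae hg.measurableSet (ae_of_all _ hg.bound)

lemma ae_historyLaw (hg : ν.IsRoundBounded g C) (π : Policy N) (T : ℕ) :
    ∀ᵐ h ∂(ν.historyLaw π T), ∀ t : Fin T, |g (h t)| ≤ C := by
  induction T with
  | zero => exact ae_of_all _ fun h t => t.elim0
  | succ T ih =>
    have hms (n : ℕ) : MeasurableSet {h : History N n | ∀ t : Fin n, |g (h t)| ≤ C} := by
      rw [Set.ofPred_forall]
      exact MeasurableSet.iInter fun t =>
        measurableSet_le (hg.measurable.comp (measurable_pi_apply t)).abs measurable_const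
    rw [historyLaw_succ, ae_map_iff (measurable_snoc T).aemeasurable (hms _)]
    refine Measure.ae_compProd_of_ae_ae (measurable_snoc T (hms _)) ?_
    filter_upwards [ih] with h hh
    filter_upwards [hg.ae_roundKernel π T h] with r hr t
    refine Fin.lastCases ?_ (fun k => ?_) t
    · simpa using hr
    · simpa using hh k

lemma measurable_sum (hg : ν.IsRoundBounded g C) (T : ℕ) :
    Measurable fun h : History N T => ∑ t, g (h t) :=
  Finset.measurable_sum _ fun t _ => hg.measurable.comp (measurable_pi_apply t)

lemma integrable_sum (hg : ν.IsRoundBounded g C) (π : Policy N) (T : ℕ) :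
    Integrable (fun h : History N T => ∑ t, g (h t)) (ν.historyLaw π T) := by
  refine Integrable.of_bound (hg.measurable_sum T).aestronglyMeasurable (T * C) ?_
  filter_upwards [hg.ae_historyLaw π T] with h hh
  calc ‖∑ t, g (h t)‖ ≤ ∑ _t : Fin T, C := norm_sum_le_of_le _ fun t _ => hh t
    _ = T * C := by simp

lemma integrable_roundKernel (hg : ν.IsRoundBounded g C) (π : Policy N) (t : ℕ)
    (h : History N t) : Integrable g (ν.roundKernel π t h) :=
  Integrable.of_bound hg.measurable.aestronglyMeasurable C (hg.ae_roundKernel π t h)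

lemma integrable_compProd (hg : ν.IsRoundBounded g C) (π : Policy N) (T : ℕ) :
    Integrable (fun p : History N T × Round N => g p.2)
      (ν.historyLaw π T ⊗ₘ ν.roundKernel π T) :=
  Integrable.of_bound (hg.measurable.comp measurable_snd).aestronglyMeasurable C
    (Measure.ae_compProd_of_ae_ae (measurable_snd hg.measurableSet)
      (ae_of_all _ (hg.ae_roundKernel π T)))

lemma integral_roundKernel (hg : ν.IsRoundBounded g C) (π : Policy N) (t : ℕ) (h : History N t) :
    ∫ r, g r ∂(ν.roundKernel π t h) =
      ∫ a, ∫ x, g (a, x) ∂(ν.rewardKernel a) ∂(π.propose t h) := by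
  have := hg.integrable_roundKernel π t h
  rw [roundKernel_apply] at this ⊢
  exact Measure.integral_compProd this

lemma integral_sum_succ (hg : ν.IsRoundBounded g C) (π : Policy N) (T : ℕ) :
    ∫ h : History N (T + 1), ∑ t, g (h t) ∂(ν.historyLaw π (T + 1)) =
      ∫ h : History N T, ∑ t, g (h t) ∂(ν.historyLaw π T) +
        ∫ h, ∫ r, g r ∂(ν.roundKernel π T h) ∂(ν.historyLaw π T) := by
  have h1 : Integrable (fun p : History N T × Round N => ∑ t, g (p.1 t))
      (ν.historyLaw π T ⊗ₘ ν.roundKernel π T) := by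
    have := hg.integrable_sum π T
    rw [← Measure.fst_compProd (ν.historyLaw π T) (ν.roundKernel π T)] at this
    exact this.comp_measurable measurable_fst
  rw [historyLaw_succ, integral_map (measurable_snoc T).aemeasurable
    (hg.measurable_sum _).aestronglyMeasurable]
  simp only [Fin.sum_univ_castSucc, Fin.snoc_castSucc, Fin.snoc_last]
  rw [integral_add h1 (hg.integrable_compProd π T), Measure.integral_compProd h1,
    Measure.integral_compProd (hg.integrable_compProd π T)]
  simp

/-- The expected total of a function of the rounds depends only on its mean given the proposals. -/
lemma integral_sum_congr {g' : Round N → ℝ} {C' : ℝ} (hg : ν.IsRoundBounded g C)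
    (hg' : ν.IsRoundBounded g' C')
    (h : ∀ a, ∫ x, g (a, x) ∂(ν.rewardKernel a) = ∫ x, g' (a, x) ∂(ν.rewardKernel a))
    (π : Policy N) (T : ℕ) :
    ∫ h : History N T, ∑ t, g (h t) ∂(ν.historyLaw π T) =
      ∫ h : History N T, ∑ t, g' (h t) ∂(ν.historyLaw π T) := by
  induction T with
  | zero => simp
  | succ T ih =>
    rw [hg.integral_sum_succ, hg'.integral_sum_succ, ih]
    simp_rw [hg.integral_roundKernel, hg'.integral_roundKernel, h]

end IsRoundBounded

lemma isRoundBounded_proposals (ν : Instance N) (w : Proposals N → ℝ) :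
    ν.IsRoundBounded (fun r => w r.1) (∑ a, |w a|) where
  measurable := (Measurable.of_discrete (f := w)).comp measurable_fst
  bound a := ae_of_all _ fun _ =>
    Finset.single_le_sum (f := fun a => |w a|) (fun _ _ => abs_nonneg _) (Finset.mem_univ a)

lemma isRoundBounded_reward (ν : Instance N) (i : Fin N) :
    ν.IsRoundBounded (fun r => r.2 i) 1 where
  measurable := (measurable_pi_apply i).comp measurable_snd
  bound a := by
    have := (measurePreserving_eval (ν.rewardLaw a) i).quasiMeasurePreserving.ae
      (ν.rewardLaw_ae_mem a i)
    rw [rewardKernel_apply]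
    filter_upwards [this] with x hx
    rw [abs_of_nonneg hx.1]; exact hx.2

/-- The expected total over `T` rounds of a function of the joint proposals. -/
def expectedTotal (ν : Instance N) (π : Policy N) (T : ℕ) (w : Proposals N → ℝ) : ℝ :=
  ∫ h : History N T, ∑ t, w (h t).1 ∂(ν.historyLaw π T)

lemma expectedTotal_mono (ν : Instance N) (π : Policy N) (T : ℕ) {w w' : Proposals N → ℝ}
    (h : ∀ a, w a ≤ w' a) : ν.expectedTotal π T w ≤ ν.expectedTotal π T w' :=
  integral_mono ((ν.isRoundBounded_proposals w).integrable_sum π T)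
    ((ν.isRoundBounded_proposals w').integrable_sum π T)
    fun _ => Finset.sum_le_sum fun _ _ => h _

lemma expectedTotal_const_mul (ν : Instance N) (π : Policy N) (T : ℕ) (c : ℝ)
    (w : Proposals N → ℝ) :
    ν.expectedTotal π T (fun a => c * w a) = c * ν.expectedTotal π T w := by
  simp only [expectedTotal, ← Finset.mul_sum, integral_const_mul]

lemma expectedTotal_sum (ν : Instance N) (π : Policy N) (T : ℕ) {ι : Type*} (s : Finset ι)
    (w : ι → Proposals N → ℝ) :
    ν.expectedTotal π T (fun a => ∑ k ∈ s, w k a) = ∑ k ∈ s, ν.expectedTotal π T (w k) := by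
  simp only [expectedTotal]
  rw [← integral_finsetSum _ fun k _ => (ν.isRoundBounded_proposals (w k)).integrable_sum π T]
  simp_rw [Finset.sum_comm (s := Finset.univ) (t := s)]

lemma expectedTotal_const_sub (ν : Instance N) (π : Policy N) (T : ℕ) (c : ℝ)
    (w : Proposals N → ℝ) :
    ν.expectedTotal π T (fun a => c - w a) = T * c - ν.expectedTotal π T w := by
  simp only [expectedTotal, Finset.sum_sub_distrib, Finset.sum_const, Finset.card_univ,
    Fintype.card_fin, nsmul_eq_mul]
  rw [integral_sub (integrable_const _) ((ν.isRoundBounded_proposals w).integrable_sum π T)]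
  simp

/-- By conditioning on the proposals, rewards are replaced by their means, so regret bounds can be
checked proposal by proposal. -/
lemma coreRegret_eq (ν : Instance N) (μ : Equiv.Perm (Fin N)) (π : Policy N) (i : Fin N)
    (T : ℕ) : ν.coreRegret μ π i T =
      ν.expectedTotal π T fun a => ν.utility i (μ i) - ν.meanReward i a := by
  rw [expectedTotal_const_sub, coreRegret, expectedTotal]
  congr 1
  refine (ν.isRoundBounded_reward i).integral_sum_congr
    (ν.isRoundBounded_proposals (ν.meanReward i)) (fun a => ?_) π T
  simp only [integral_const, probReal_univ, one_smul, rewardKernel_apply]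
  exact integral_comp_eval (μ := ν.rewardLaw a) (i := i) (f := fun y : ℝ => y)
    measurable_id.aestronglyMeasurable

/-- The indicator of the event that player `i` is matched to arm `j`. -/
def matchIndicator (i j : Fin N) (a : Proposals N) : ℝ := if matchedArm a i = some j then 1 else 0

lemma matchIndicator_nonneg (i j : Fin N) (a : Proposals N) : 0 ≤ matchIndicator i j a := by
  unfold matchIndicator; split_ifs <;> simp

lemma matchIndicator_le_one (i j : Fin N) (a : Proposals N) : matchIndicator i j a ≤ 1 := by
  unfold matchIndicator; split_ifs <;> simp

/-- The expected number of rounds in which player `i` is matched to arm `j`. -/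
def expectedMatches (ν : Instance N) (π : Policy N) (i j : Fin N) (T : ℕ) : ℝ :=
  ν.expectedTotal π T (matchIndicator i j)

lemma expectedMatches_nonneg (ν : Instance N) (π : Policy N) (i j : Fin N) (T : ℕ) :
    0 ≤ ν.expectedMatches π i j T :=
  integral_nonneg fun _ => Finset.sum_nonneg fun _ _ => matchIndicator_nonneg _ _ _

lemma expectedMatches_succ (ν : Instance N) (π : Policy N) (i j : Fin N) (T : ℕ) :
    ν.expectedMatches π i j (T + 1) = ν.expectedMatches π i j T +
      ∫ h, ∫ a, matchIndicator i j a ∂(π.propose T h) ∂(ν.historyLaw π T) := by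
  have hb := ν.isRoundBounded_proposals (matchIndicator i j)
  rw [expectedMatches, expectedTotal, hb.integral_sum_succ]
  simp_rw [hb.integral_roundKernel]
  simp [expectedMatches, expectedTotal]

/-! ### Divergence decomposition for histories -/

/-- If two instances differ only in the pair `(i, j)`, then the relative entropy of the laws of the
history is at most the expected number of matches of this pair times that of its rewards. -/
lemma entropyBound_historyLaw {ν ν' : Instance N} {i j : Fin N} {c : ℝ}
    (h : ∀ k l, ¬ (k = i ∧ l = j) → ν'.law k l = ν.law k l)
    (hc : EntropyBound (ν.law i j) (ν'.law i j) c) (π : Policy N) (T : ℕ) :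
    EntropyBound (ν.historyLaw π T) (ν'.historyLaw π T) (c * ν.expectedMatches π i j T) := by
  have hlaw (a : Proposals N) (k : Fin N) (hk : ¬ (k = i ∧ matchedArm a k = some j)) :
      ν.rewardLaw a k = ν'.rewardLaw a k := by
    unfold rewardLaw
    split
    · next l hl => rw [h]; rintro ⟨rfl, rfl⟩; exact hk ⟨rfl, hl⟩
    · rfl
  have hreward (a : Proposals N) :
      EntropyBound (ν.rewardKernel a) (ν'.rewardKernel a) (c * matchIndicator i j a) := by
    rw [rewardKernel_apply, rewardKernel_apply]
    by_cases ha : matchedArm a i = some j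
    · refine EntropyBound.pi (i := i) ?_ fun k hk => hlaw a k fun h => hk h.1
      simpa [matchIndicator, rewardLaw, ha] using hc
    · have : ν.rewardLaw a = ν'.rewardLaw a :=
        funext fun k => hlaw a k fun hk => ha (hk.1 ▸ hk.2)
      simpa [matchIndicator, this, ha] using EntropyBound.refl _
  have hround (t : ℕ) (h : History N t) :
      EntropyBound (ν.roundKernel π t h) (ν'.roundKernel π t h)
        (c * ∫ a, matchIndicator i j a ∂(π.propose t h)) := by
    rw [roundKernel_apply, roundKernel_apply]
    -- Given the past, both instances draw proposals from the same law, so only the rewards cost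
    -- entropy.
    have := (EntropyBound.refl (π.propose t h)).compProd hreward (.of_finite)
    rwa [integral_const_mul, zero_add] at this
  induction T with
  | zero => simpa [expectedMatches, expectedTotal, historyLaw] using EntropyBound.refl _
  | succ T ih =>
    rw [expectedMatches_succ, historyLaw_succ, historyLaw_succ, mul_add, ← integral_const_mul]
    refine EntropyBound.map (ih.compProd (hround T) (.const_mul ?_ c)) (measurable_snoc T)
    refine Integrable.of_bound (StronglyMeasurable.integral_kernel (κ := π.propose T)
      (Measurable.of_discrete (f := matchIndicator i j)).stronglyMeasurable).aestronglyMeasurable 1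
      (ae_of_all _ fun h => ?_)
    refine (norm_integral_le_of_norm_le_const (C := 1) (ae_of_all _ fun a => ?_)).trans (by simp)
    rw [Real.norm_of_nonneg (matchIndicator_nonneg _ _ _)]
    exact matchIndicator_le_one _ _ _

end Instance

/-! ### Regret and match counts -/

lemma matchedArm_injective {N : ℕ} {a : Proposals N} {i i' j : Fin N}
    (h : matchedArm a i = some j) (h' : matchedArm a i' = some j) : i = i' := by
  unfold matchedArm at h h'
  split_ifs at h with hi
  split_ifs at h' with hi'
  exact (hi i' (h'.trans h.symm)).symm

/-- The chord lies above the convex exponential. This controls an exponential moment by an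
expectation alone, which is all that a regret bound supplies. -/
lemma exp_mul_le_of_mem_Icc {l z : ℝ} (h0 : 0 ≤ z) (h1 : z ≤ 1) :
    Real.exp (l * z) ≤ 1 + (Real.exp l - 1) * z := by
  have := convexOn_exp.2 (Set.mem_univ 0) (Set.mem_univ l) (sub_nonneg.2 h1) h0 (by ring)
  simp only [smul_eq_mul, mul_zero, zero_add, Real.exp_zero, mul_one] at this
  rw [mul_comm l z]
  linarith

namespace Instance

variable {N : ℕ} {ν : Instance N} {μ : Equiv.Perm (Fin N)}

lemma expectedMatches_le (ν : Instance N) (π : Policy N) (i j : Fin N) (T : ℕ) :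
    ν.expectedMatches π i j T ≤ T := by
  have h1 := ν.expectedTotal_const_sub π T 1 (matchIndicator i j)
  have h2 : 0 ≤ ν.expectedTotal π T fun a => 1 - matchIndicator i j a :=
    integral_nonneg fun _ => Finset.sum_nonneg fun _ _ =>
      sub_nonneg.2 (matchIndicator_le_one _ _ _)
  rw [expectedMatches]
  linarith

lemma meanReward_le {i : Fin N} {x : ℝ} (hx : ∀ j, ν.utility i j ≤ x) (a : Proposals N) :
    ν.meanReward i a ≤ x := by
  rcases h : matchedArm a i with _ | j
  · rw [meanReward_of_eq_none h]; exact (ν.utility_nonneg i i).trans (hx i)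
  · rw [meanReward_of_eq_some h]; exact hx j

lemma IsSTTCB.utility_le (hν : ν.IsSTTCB μ) (i j : Fin N) :
    ν.utility i j ≤ ν.utility i (μ i) := by
  by_cases h : j = μ i
  · rw [h]
  · exact (hν.top i j h).le

lemma IsSTTCB.gap_nonneg (hν : ν.IsSTTCB μ) (i j : Fin N) : 0 ≤ ν.gap μ i j :=
  sub_nonneg.2 (hν.utility_le i j)

/-- In each round at most one term is present, and it equals the loss; an unmatched player loses a
nonnegative amount. -/
lemma IsSTTCB.sum_gap_mul_expectedMatches_le (hν : ν.IsSTTCB μ) (π : Policy N) (i : Fin N)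
    (T : ℕ) :
    ∑ j ∈ Finset.univ.erase (μ i), ν.gap μ i j * ν.expectedMatches π i j T ≤
      ν.coreRegret μ π i T := by
  simp only [expectedMatches, ← expectedTotal_const_mul]
  rw [← expectedTotal_sum, coreRegret_eq]
  refine ν.expectedTotal_mono π T fun a => ?_
  rcases h : matchedArm a i with _ | l
  · simpa [matchIndicator, h, meanReward_of_eq_none h] using ν.utility_nonneg i (μ i)
  · simp only [matchIndicator, h, meanReward_of_eq_some h, Option.some.injEq, mul_ite, mul_one,
      mul_zero, Finset.sum_ite_eq, Finset.mem_erase, Finset.mem_univ, and_true]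
    split_ifs
    · exact le_rfl
    · exact hν.gap_nonneg i l

lemma minGap_le {i j : Fin N} (hj : j ≠ μ i) : ν.minGap μ i ≤ ν.gap μ i j :=
  ciInf_le (Set.finite_range _).bddBelow (⟨j, hj⟩ : {j : Fin N // j ≠ μ i})

lemma IsSTTCB.minGap_nonneg (hν : ν.IsSTTCB μ) (i : Fin N) : 0 ≤ ν.minGap μ i :=
  Real.iInf_nonneg fun j => hν.gap_nonneg i j

lemma minGap_le_utility (ν : Instance N) (μ : Equiv.Perm (Fin N)) (i : Fin N) :
    ν.minGap μ i ≤ ν.utility i (μ i) := by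
  by_cases h : ∃ j, j ≠ μ i
  · obtain ⟨j, hj⟩ := h
    exact (minGap_le hj).trans (sub_le_self _ (ν.utility_nonneg i j))
  -- Without any other arm, the real infimum over the empty family is `0`.
  · have : IsEmpty {j : Fin N // j ≠ μ i} := ⟨fun j => h ⟨j, j.2⟩⟩
    rw [minGap, Real.iInf_of_isEmpty]
    exact ν.utility_nonneg i _

/-- At most one other player holds arm `μ i` in a round, and then player `i` has an inferior arm or
none, losing at least the minimum gap either way. -/
lemma IsSTTCB.minGap_mul_sum_expectedMatches_le (hν : ν.IsSTTCB μ) (π : Policy N) (i : Fin N)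
    (T : ℕ) :
    ∑ i' ∈ Finset.univ.erase i, ν.minGap μ i * ν.expectedMatches π i' (μ i) T ≤
      ν.coreRegret μ π i T := by
  simp only [expectedMatches, ← expectedTotal_const_mul]
  rw [← expectedTotal_sum, coreRegret_eq]
  refine ν.expectedTotal_mono π T fun a => ?_
  by_cases hex : ∃ l, l ≠ i ∧ matchedArm a l = some (μ i)
  · obtain ⟨l, hli, hl⟩ := hex
    have hone (k : Fin N) : matchIndicator k (μ i) a = if l = k then 1 else 0 := by
      unfold matchIndicator
      refine if_congr ⟨fun h => matchedArm_injective hl h, ?_⟩ rfl rfl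
      rintro rfl; exact hl
    simp only [hone, mul_ite, mul_one, mul_zero, Finset.sum_ite_eq, Finset.mem_erase,
      Finset.mem_univ, and_true, if_pos hli]
    rcases h : matchedArm a i with _ | j
    · rw [meanReward_of_eq_none h, sub_zero]; exact ν.minGap_le_utility μ i
    · rw [meanReward_of_eq_some h]
      refine minGap_le (μ := μ) (i := i) (j := j) ?_
      rintro rfl
      exact hli (matchedArm_injective hl h)
  · push Not at hex
    rw [Finset.sum_eq_zero fun k hk => ?_]
    · exact sub_nonneg.2 (meanReward_le (hν.utility_le i) a)
    · simp [matchIndicator, hex k (Finset.ne_of_mem_erase hk)]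

lemma IsSTTCB.coreRegret_nonneg (hν : ν.IsSTTCB μ) (π : Policy N) (i : Fin N) (T : ℕ) :
    0 ≤ ν.coreRegret μ π i T :=
  (Finset.sum_nonneg fun j _ => mul_nonneg (hν.gap_nonneg i j)
    (ν.expectedMatches_nonneg π i j T)).trans (hν.sum_gap_mul_expectedMatches_le π i T)

/-- If the core partner of player `i` is better by `c` than all other arms, then each round in
which player `i` is not matched to it costs at least `c`. -/
lemma mul_sub_expectedMatches_le {i : Fin N} {c x : ℝ} (hc : ν.utility i (μ i) = x + c)
    (hx0 : 0 ≤ x) (hx : ∀ j, j ≠ μ i → ν.utility i j ≤ x) (π : Policy N) (T : ℕ) :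
    c * (T - ν.expectedMatches π i (μ i) T) ≤ ν.coreRegret μ π i T := by
  rw [coreRegret_eq]
  have := ν.expectedTotal_const_sub π T 1 (matchIndicator i (μ i))
  rw [mul_one] at this
  rw [expectedMatches, ← this, ← expectedTotal_const_mul]
  refine ν.expectedTotal_mono π T fun a => ?_
  rcases h : matchedArm a i with _ | l
  · simp [matchIndicator, h, meanReward_of_eq_none h]; linarith
  · by_cases hl : l = μ i
    · simp [matchIndicator, h, meanReward_of_eq_some h, hl]
    · have := hx l hl
      simp [matchIndicator, h, meanReward_of_eq_some h, hl]; linarith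

/-- The inequality behind the lower bound: few matches of the pair `(i, j)` in one instance and
many in another one require a large relative entropy. -/
lemma mul_one_sub_le_of_entropyBound {ν' : Instance N} {i j : Fin N} {k l : ℝ} {T : ℕ}
    {π : Policy N} (hT : 0 < T)
    (h : EntropyBound (ν.historyLaw π T) (ν'.historyLaw π T) k) :
    l * (1 - ν.expectedMatches π i j T / T) ≤
      k + Real.log (1 + (Real.exp l - 1) * ((T - ν'.expectedMatches π i j T) / T)) := by
  have hT' : (0 : ℝ) < T := by exact_mod_cast hT
  -- The fraction of rounds without the match `(i, j)`; the test function is `l * z`.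
  set z : History N T → ℝ := fun h => 1 - (∑ t, matchIndicator i j (h t).1) / T with hz
  have hsum (ν : Instance N) := (ν.isRoundBounded_proposals (matchIndicator i j)).integrable_sum π T
  have hzm : Measurable z := measurable_const.sub
    (((ν.isRoundBounded_proposals (matchIndicator i j)).measurable_sum T).div_const _)
  have hz0 (h) : 0 ≤ z h := by
    rw [hz, sub_nonneg, div_le_one hT']
    calc ∑ t, matchIndicator i j (h t).1 ≤ ∑ _t : Fin T, (1 : ℝ) :=
          Finset.sum_le_sum fun _ _ => matchIndicator_le_one _ _ _
      _ = T := by simp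
  have hz1 (h) : z h ≤ 1 := sub_le_self _
    (div_nonneg (Finset.sum_nonneg fun _ _ => matchIndicator_nonneg _ _ _) hT'.le)
  have hint (ν : Instance N) :
      ∫ h, z h ∂(ν.historyLaw π T) = 1 - ν.expectedMatches π i j T / T := by
    rw [hz, integral_sub (integrable_const _) ((hsum ν).div_const _), integral_div]
    simp [expectedMatches, expectedTotal]
  have hzi (ν : Instance N) : Integrable z (ν.historyLaw π T) :=
    (integrable_const _).sub ((hsum ν).div_const _)
  have hlz (h) : |l * z h| ≤ |l| := by
    rw [abs_mul, abs_of_nonneg (hz0 h)]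
    exact mul_le_of_le_one_right (abs_nonneg _) (hz1 h)
  have key := h (fun h => l * z h) (hzm.const_mul l) |l| hlz
  rw [integral_const_mul, hint] at key
  refine key.trans (add_le_add_right (Real.log_le_log ?_ ?_) _)
  · exact integral_exp_pos (integrable_exp_of_abs_le (hzm.const_mul l) hlz)
  · calc ∫ h, Real.exp (l * z h) ∂(ν'.historyLaw π T)
        ≤ ∫ h, (1 + (Real.exp l - 1) * z h) ∂(ν'.historyLaw π T) :=
          integral_mono (integrable_exp_of_abs_le (hzm.const_mul l) hlz)
            ((integrable_const _).add ((hzi ν').const_mul _))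
            fun h => exp_mul_le_of_mem_Icc (hz0 h) (hz1 h)
      _ = _ := by
          rw [integral_add (integrable_const _) ((hzi ν').const_mul _), integral_const_mul, hint,
            sub_div, div_self hT'.ne']
          simp

end Instance

/-! ### Logarithmic lower bounds on match counts -/

lemma IsUniformlyConsistent.eventually_le {N : ℕ} {π : ℕ → Policy N}
    (hπ : IsUniformlyConsistent π) {ν : Instance N} {μ : Equiv.Perm (Fin N)}
    (hμ : ν.IsCoreMatching μ) (i : Fin N) {α : ℝ} (h0 : 0 < α) (h1 : α < 1) :
    ∀ᶠ T : ℕ in atTop, ν.coreRegret μ (π T) i T ≤ (T : ℝ) ^ α := by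
  have h := eventually_lt_of_limsup_lt ((hπ ν μ hμ i α h0 h1).trans_lt zero_lt_one)
  filter_upwards [h, eventually_gt_atTop 0] with T hT hT0
  have hT' : (0 : ℝ) < (T : ℝ) ^ α := Real.rpow_pos_of_pos (by exact_mod_cast hT0) α
  have : ν.coreRegret μ (π T) i T / (T : ℝ) ^ α < 1 := by exact_mod_cast hT
  exact ((div_lt_one hT').1 this).le

/-- The number of matches of a pair outside of the core, for the relative entropy to one alternative
distribution. -/
lemma eventually_mul_log_le_expectedMatches {N : ℕ} {ν : Instance N} {μ : Equiv.Perm (Fin N)}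
    (hν : ν.IsSTTCB μ) {π : ℕ → Policy N} (hπ : IsUniformlyConsistent π) {i j : Fin N}
    (hj : j ≠ μ i) {m : Measure ℝ} (hm : m ∈ RewardDist) (hmean : ν.utility i (μ i) < mean m)
    (hkl : InformationTheory.klDiv (ν.law i j) m ≠ ∞) {b : ℝ} (hb : b < 1) :
    ∀ᶠ T : ℕ in atTop, b * Real.log T ≤
      (InformationTheory.klDiv (ν.law i j) m).toReal * ν.expectedMatches (π T) i j T := by
  obtain ⟨α, hα0, hα⟩ : ∃ α : ℝ, 0 < α ∧ α < 1 ∧ b < 1 - α := by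
    refine ⟨min (1 / 2) ((1 - b) / 2), lt_min (by norm_num) (by linarith), ?_, ?_⟩
    · exact (min_le_left _ _).trans_lt (by norm_num)
    · linarith [min_le_right (1 / 2) ((1 - b) / 2)]
  obtain ⟨hα1, hbα⟩ := hα
  have htop (j') : ν.utility i j' < mean m := (hν.utility_le i j').trans_lt hmean
  set ν' := ν.update i j m hm htop with hν'
  obtain ⟨μ', hμ'⟩ := ν'.exists_isCoreMatching
  have hμ'i : μ' i = j := hν.update_core hμ'
  set c := mean m - ν.utility i (μ i) with hc
  have hc0 : 0 < c := sub_pos.2 hmean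
  have hd0 : 0 < ν.gap μ i j := sub_pos.2 (hν.top i j hj)
  set d := ν.gap μ i j with hd
  have hP : IsProbabilityMeasure (ν.law i j) := (ν.law_mem i j).1
  have hQ : IsProbabilityMeasure m := hm.1
  set K := (InformationTheory.klDiv (ν.law i j) m).toReal with hK
  have hent (T : ℕ) : EntropyBound (ν.historyLaw (π T) T) (ν'.historyLaw (π T) T)
      (K * ν.expectedMatches (π T) i j T) := by
    refine Instance.entropyBound_historyLaw (fun k l h => Instance.update_law_of_ne h) ?_ (π T) T
    rw [Instance.update_law_self]
    exact EntropyBound.of_klDiv_ne_top hkl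
  -- The lower bound for entropy divided by `log T` that results below; its limit is `1 - α > b`.
  have hlim : Tendsto (fun T : ℕ => (1 - α) * (1 - (T : ℝ) ^ (-(1 - α)) / d) -
      Real.log (1 + 1 / c) / Real.log T) atTop (nhds ((1 - α) * (1 - 0 / d) - 0)) := by
    refine (Tendsto.const_mul _ (tendsto_const_nhds.sub (Tendsto.div_const ?_ _))).sub ?_
    · exact (tendsto_rpow_neg_atTop (by linarith)).comp tendsto_natCast_atTop_atTop
    · exact Tendsto.div_atTop tendsto_const_nhds
        (Real.tendsto_log_atTop.comp tendsto_natCast_atTop_atTop)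
  have hlim' := hlim.eventually_const_lt (u := b) (by simpa using hbα)
  filter_upwards [hlim', hπ.eventually_le hν.core i hα0 hα1, hπ.eventually_le hμ' i hα0 hα1,
    eventually_ge_atTop 2] with T hT h1 h2 hT2
  have hT0 : (0 : ℝ) < T := by positivity
  have hlog : 0 < Real.log T := Real.log_pos (by exact_mod_cast hT2)
  have hE : ν.expectedMatches (π T) i j T / T ≤ (T : ℝ) ^ (-(1 - α)) / d := by
    have h3 : d * ν.expectedMatches (π T) i j T ≤ ν.coreRegret μ (π T) i T :=
      (Finset.single_le_sum (f := fun j => ν.gap μ i j * ν.expectedMatches (π T) i j T)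
        (fun j _ => mul_nonneg (hν.gap_nonneg i j) (ν.expectedMatches_nonneg _ _ _ _))
        (Finset.mem_erase.2 ⟨hj, Finset.mem_univ j⟩)).trans
        (hν.sum_gap_mul_expectedMatches_le (π T) i T)
    have h4 : (T : ℝ) ^ (-(1 - α)) = (T : ℝ) ^ α / T := by
      rw [neg_sub, Real.rpow_sub_one hT0.ne']
    rw [h4, div_div, mul_comm (T : ℝ), ← div_div, div_le_div_iff_of_pos_right hT0,
      le_div_iff₀ hd0, mul_comm]
    exact h3.trans h1
  have hE' : (T - ν'.expectedMatches (π T) i j T) / T ≤ (T : ℝ) ^ (-(1 - α)) / c := by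
    have h3 : c * (T - ν'.expectedMatches (π T) i (μ' i) T) ≤ ν'.coreRegret μ' (π T) i T := by
      refine Instance.mul_sub_expectedMatches_le (x := ν.utility i (μ i)) ?_
        (ν.utility_nonneg _ _) (fun l hl => ?_) (π T) T
      · rw [hμ'i, hν', Instance.update_utility_self]; ring
      · rw [hν', Instance.update_utility_of_ne (by rintro ⟨-, rfl⟩; exact hl hμ'i.symm)]
        exact hν.utility_le i l
    rw [hμ'i] at h3
    have h4 : (T : ℝ) ^ (-(1 - α)) = (T : ℝ) ^ α / T := by
      rw [neg_sub, Real.rpow_sub_one hT0.ne']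
    rw [h4, div_div, mul_comm (T : ℝ), ← div_div, div_le_div_iff_of_pos_right hT0,
      le_div_iff₀ hc0, mul_comm]
    exact h3.trans h2
  -- With this `l`, `exp l = T ^ (1 - α)` cancels the decay of the unmatched fraction under `ν'`, so
  -- the logarithmic term stays below `log (1 + 1 / c)`.
  have key := Instance.mul_one_sub_le_of_entropyBound (i := i) (j := j)
    (l := (1 - α) * Real.log T) (by omega) (hent T)
  have hexp : Real.exp ((1 - α) * Real.log T) = (T : ℝ) ^ (1 - α) := by
    rw [Real.rpow_def_of_pos hT0, mul_comm]
  have hexp1 : 1 ≤ (T : ℝ) ^ (1 - α) :=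
    Real.one_le_rpow (by exact_mod_cast (by omega : 1 ≤ T)) (by linarith)
  have hEn : 0 ≤ (T - ν'.expectedMatches (π T) i j T) / T :=
    div_nonneg (sub_nonneg.2 (ν'.expectedMatches_le _ _ _ _)) hT0.le
  have hl : Real.log (1 + (Real.exp ((1 - α) * Real.log T) - 1) *
      ((T - ν'.expectedMatches (π T) i j T) / T)) ≤ Real.log (1 + 1 / c) := by
    rw [hexp]
    refine Real.log_le_log (by have := mul_nonneg (sub_nonneg.2 hexp1) hEn; linarith) ?_
    have h5 : (T : ℝ) ^ (1 - α) * ((T : ℝ) ^ (-(1 - α)) / c) = 1 / c := by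
      rw [← mul_div_assoc, ← Real.rpow_add hT0]; simp
    have h6 := mul_le_mul_of_nonneg_left hE' (zero_le_one.trans hexp1)
    rw [h5] at h6
    linarith
  have h7 : (1 - α) * Real.log T * (1 - (T : ℝ) ^ (-(1 - α)) / d) ≤
      (1 - α) * Real.log T * (1 - ν.expectedMatches (π T) i j T / T) := by
    have : 0 ≤ (1 - α) * Real.log T := mul_nonneg (by linarith) hlog.le
    gcongr
  have h8 := mul_le_mul_of_nonneg_right hT.le hlog.le
  rw [sub_mul, div_mul_cancel₀ _ hlog.ne'] at h8
  linarith

/-- The asymptotic number of matches of a pair outside of the core. -/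
lemma inv_Dinf_le_liminf_expectedMatches {N : ℕ} {ν : Instance N} {μ : Equiv.Perm (Fin N)}
    (hν : ν.IsSTTCB μ) {π : ℕ → Policy N} (hπ : IsUniformlyConsistent π) {i j : Fin N}
    (hj : j ≠ μ i) :
    (Dinf (ν.law i j) (ν.utility i (μ i)))⁻¹ ≤
      liminf (fun T : ℕ => ENNReal.ofReal (ν.expectedMatches (π T) i j T / Real.log T)) atTop := by
  -- Inversion turns the infimum into a supremum, so each `m` is treated separately, and no
  -- minimizer is needed.
  rw [Dinf, ENNReal.inv_iInf]
  refine iSup_le fun m => ?_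
  rw [ENNReal.inv_iInf]
  refine iSup_le fun ⟨hm, hmean⟩ => ?_
  by_cases hkl : InformationTheory.klDiv (ν.law i j) m = ∞
  · simp [hkl]
  have hP : IsProbabilityMeasure (ν.law i j) := (ν.law_mem i j).1
  have hQ : IsProbabilityMeasure m := hm.1
  have hK0 : InformationTheory.klDiv (ν.law i j) m ≠ 0 := by
    rw [Ne, InformationTheory.klDiv_eq_zero_iff]
    rintro rfl
    exact (hν.utility_le i j).not_gt hmean
  have hK : 0 < (InformationTheory.klDiv (ν.law i j) m).toReal := ENNReal.toReal_pos hK0 hkl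
  rw [← ENNReal.ofReal_toReal hkl, ← ENNReal.ofReal_inv_of_pos hK]
  set K := (InformationTheory.klDiv (ν.law i j) m).toReal
  have hlim : Tendsto (fun b : ℝ => ENNReal.ofReal (b * K⁻¹)) (nhdsWithin 1 (Set.Iio 1))
      (nhds (ENNReal.ofReal (1 * K⁻¹))) :=
    ((ENNReal.continuous_ofReal.comp (continuous_mul_const K⁻¹)).tendsto 1).mono_left
      nhdsWithin_le_nhds
  rw [← one_mul K⁻¹]
  refine le_of_tendsto hlim ?_
  filter_upwards [self_mem_nhdsWithin] with b hb
  refine le_liminf_of_le (by isBoundedDefault) ?_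
  filter_upwards [eventually_mul_log_le_expectedMatches hν hπ hj hm hmean hkl hb,
    eventually_ge_atTop 2] with T hT hT2
  have hlog : 0 < Real.log T := Real.log_pos (by exact_mod_cast hT2)
  refine ENNReal.ofReal_le_ofReal ?_
  rw [← div_eq_mul_inv, div_le_div_iff₀ hK hlog]
  linarith

/-! ### From match counts to regret -/

lemma sum_liminf_le_liminf_sum {ι : Type*} (s : Finset ι) (u : ι → ℕ → ℝ≥0∞) :
    ∑ k ∈ s, liminf (u k) atTop ≤ liminf (fun T => ∑ k ∈ s, u k T) atTop := by
  classical
  induction s using Finset.induction_on with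
  | empty => simp
  | insert a s ha ih =>
    simp only [Finset.sum_insert ha]
    refine (add_le_add_right ih _).trans ?_
    simp only [liminf_eq_iSup_iInf_of_nat]
    have hmono (v : ℕ → ℝ≥0∞) : Monotone fun n => ⨅ i ≥ n, v i := fun _ _ h =>
      biInf_mono fun _ hi => h.trans hi
    rw [ENNReal.iSup_add_iSup_of_monotone (hmono _) (hmono _)]
    exact iSup_mono fun n => le_iInf₂ fun T hT => add_le_add (iInf₂_le T hT) (iInf₂_le T hT)

/-- Combines lower bounds for several numbers of matches to a lower bound for a regret `R`. -/
lemma sum_div_le_liminf {ι : Type*} {s : Finset ι} {c : ι → ℝ} {D : ι → ℝ≥0∞} {n : ι → ℕ → ℝ}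
    {R : ℕ → ℝ} (hc : ∀ k ∈ s, 0 ≤ c k) (hn : ∀ k T, 0 ≤ n k T) (hR : ∀ T, 0 ≤ R T)
    (hD : ∀ k ∈ s, (D k)⁻¹ ≤ liminf (fun T : ℕ => ENNReal.ofReal (n k T / Real.log T)) atTop)
    (h : ∀ T, ∑ k ∈ s, c k * n k T ≤ R T) :
    ((∑ k ∈ s, ENNReal.ofReal (c k) / D k : ℝ≥0∞) : EReal) ≤
      liminf (fun T : ℕ => ((R T / Real.log T : ℝ) : EReal)) atTop := by
  -- For `T ≤ 1` the logarithm is `0` and the quotients are `0` by convention, so the comparisons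
  -- hold for all `T`.
  have hlog (T : ℕ) : 0 ≤ Real.log T := Real.log_natCast_nonneg T
  have key : ∑ k ∈ s, ENNReal.ofReal (c k) / D k ≤
      liminf (fun T : ℕ => ENNReal.ofReal (R T / Real.log T)) atTop := by
    calc ∑ k ∈ s, ENNReal.ofReal (c k) / D k
        ≤ ∑ k ∈ s, liminf (fun T : ℕ => ENNReal.ofReal (c k) *
            ENNReal.ofReal (n k T / Real.log T)) atTop := by
          refine Finset.sum_le_sum fun k hk => ?_
          rw [ENNReal.liminf_const_mul_of_ne_top ENNReal.ofReal_ne_top, div_eq_mul_inv]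
          gcongr
          exact hD k hk
      _ ≤ _ := sum_liminf_le_liminf_sum _ _
      _ ≤ _ := by
          refine liminf_le_liminf (Eventually.of_forall fun T => ?_)
          calc ∑ k ∈ s, ENNReal.ofReal (c k) * ENNReal.ofReal (n k T / Real.log T)
              = ENNReal.ofReal ((∑ k ∈ s, c k * n k T) / Real.log T) := by
                rw [Finset.sum_div, ENNReal.ofReal_sum_of_nonneg fun k hk =>
                  div_nonneg (mul_nonneg (hc k hk) (hn k T)) (hlog T)]
                refine Finset.sum_congr rfl fun k hk => ?_
                rw [← ENNReal.ofReal_mul (hc k hk), mul_div_assoc]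
            _ ≤ _ := ENNReal.ofReal_le_ofReal (div_le_div_of_nonneg_right (h T) (hlog T))
  refine (EReal.coe_ennreal_le_coe_ennreal_iff.2 key).trans (le_of_eq ?_)
  rw [Monotone.map_liminf_of_continuousAt (f := ((↑) : ℝ≥0∞ → EReal))
    EReal.coe_ennreal_strictMono.monotone _ continuous_coe_ennreal_ereal.continuousAt]
  congr 1
  funext T
  simp [EReal.coe_ennreal_ofReal, max_eq_left (div_nonneg (hR T) (hlog T))]

end HousingBandit
end

theorem theorem2 {N : ℕ} (ν : HousingBandit.Instance N) (μ : Equiv.Perm (Fin N))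
    (hν : ν.IsSTTCB μ) (π : ℕ → HousingBandit.Policy N)
    (hπ : HousingBandit.IsUniformlyConsistent π) (i : Fin N) :
    ((max
        (∑ i' ∈ Finset.univ.erase i,
          ENNReal.ofReal (ν.minGap μ i) /
            HousingBandit.Dinf (ν.law i' (μ i)) (ν.utility i' (μ i')))
        (∑ j ∈ Finset.univ.erase (μ i),
          ENNReal.ofReal (ν.gap μ i j) /
            HousingBandit.Dinf (ν.law i j) (ν.utility i (μ i))) : ℝ≥0∞) : EReal)
      ≤ liminf (fun T : ℕ => ((ν.coreRegret μ (π T) i T / Real.log T : ℝ) : EReal)) atTop := by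
  rw [EReal.coe_ennreal_strictMono.monotone.map_max]
  refine max_le ?_ ?_
  -- Each other player `i'` must explore `μ i`, which is not its own core partner because `μ` is
  -- injective.
  · exact HousingBandit.sum_div_le_liminf (n := fun i' T => ν.expectedMatches (π T) i' (μ i) T)
      (fun _ _ => hν.minGap_nonneg i) (fun _ _ => ν.expectedMatches_nonneg _ _ _ _)
      (fun T => hν.coreRegret_nonneg (π T) i T)
      (fun i' hi' => HousingBandit.inv_Dinf_le_liminf_expectedMatches hν hπ
        fun h => Finset.ne_of_mem_erase hi' (μ.injective h).symm)
      (fun T => hν.minGap_mul_sum_expectedMatches_le (π T) i T)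
  · exact HousingBandit.sum_div_le_liminf (n := fun j T => ν.expectedMatches (π T) i j T)
      (fun j _ => hν.gap_nonneg i j) (fun _ _ => ν.expectedMatches_nonneg _ _ _ _)
      (fun T => hν.coreRegret_nonneg (π T) i T)
      (fun j hj => HousingBandit.inv_Dinf_le_liminf_expectedMatches hν hπ
        (Finset.ne_of_mem_erase hj))
      (fun T => hν.sum_gap_mul_expectedMatches_le (π T) i T)
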